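/- Let $n\ge 1$, and let the Möbius ladder $ML_n$ be the cubic multigraph with vertices $x_0,\dots,x_{n-1},y_0,\dots,y_{n-1}$ and with the $3n$ edges $x_iy_i$ $(0\le i\le n-1)$, $x_ix_{i+1}$ and $y_iy_{i+1}$ $(0\le i\le n-2)$, $x_{n-1}y_0$ and $y_{n-1}x_0$ (so $ML_1$ consists of two vertices joined by three parallel edges). For a signature $\sigma:E(G)\to\{\pm1\}$ on a finite loopless multigraph $G$, an orientation of $(G,\sigma)$ assigns to each half-edge $(v,e)$, where $e$ is an edge incident with the vertex $v$, a value $\tau(v,e)\in\{\pm1\}$ such that $\tau(u,e)\tau(v,e)=-\sigma(e)$ for every edge $e$ with ends $u,v$. For an integer $k\ge2$, a nowhere-zero $k$-flow of $(G,\sigma)$ is a pair $(\tau,f)$ of an orientation $\tau$ and a function $f:E(G)\to\mathbb Z$ such that $0<|f(e)|<k$ for every edge $e$ and $\sum_{e\ni v}\tau(v,e)f(e)=0$ for every vertex $v$. The signed graph $(G,\sigma)$ is flow-admissible if it admits a nowhere-zero $k$-flow for some integer $k\ge 2$. **Theorem.** For every $n\ge1$ and every signature $\sigma$ on $ML_n$,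 if $(ML_n,\sigma)$ is flow-admissible, then $(ML_n,\sigma)$ admits a nowhere-zero $6$-flow. -/

import Mathlib

/-! Signed multigraphs. The underlying graph is a loopless `Graph α β` (vertices in `α`, edges
in `β`, parallel edges allowed), and a signature is a map `σ : β → ℤˣ`, so `σ e = 1` or
`σ e = -1`. In a loopless graph the half edges are exactly the pairs `(v, e)` with `e` incident
to `v`; an orientation assigns `τ v e : ℤˣ` to such a pair, `1` meaning "away from `v`" and `-1`
"toward `v`". Values of `σ`, `τ` and flows outside the edges and half edges play no role. -/

namespace SignedGraph

variable {α β : Type*}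

/-- `τ` is an orientation of the signed graph `(G, σ)`: the two half edges of each edge `e`
satisfy `τ u e * τ v e = -σ e`. -/
def IsOrientation (G : Graph α β) [G.Loopless] (σ : β → ℤˣ) (τ : α → β → ℤˣ) : Prop :=
  ∀ ⦃e : β⦄ ⦃u v : α⦄, G.IsLink e u v → τ u e * τ v e = -σ e

open Classical in
/-- The boundary at `v` of an integer function `f` on the edges: the sum of `τ(h) f(e_h)` over
the half edges `h` incident with `v`. -/
noncomputable def boundary [Fintype β] (G : Graph α β) [G.Loopless] (τ : α → β → ℤˣ)
    (f : β → ℤ) (v : α) : ℤ :=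
  ∑ e with G.Inc e v, (τ v e : ℤ) * f e

/-- `(τ, f)` is a nowhere-zero `k`-flow of the signed graph `(G, σ)`. -/
structure IsNowhereZeroFlow [Fintype β] (G : Graph α β) [G.Loopless] (σ : β → ℤˣ) (k : ℕ)
    (τ : α → β → ℤˣ) (f : β → ℤ) : Prop where
  isOrientation : IsOrientation G σ τ
  boundary_eq_zero : ∀ v ∈ G.vertexSet, boundary G τ f v = 0
  abs_lt : ∀ e ∈ G.edgeSet, |f e| < (k : ℤ)
  ne_zero : ∀ e ∈ G.edgeSet, f e ≠ 0

/-- The signed graph `(G, σ)` admits a nowhere-zero `k`-flow. -/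
def AdmitsNowhereZeroFlow [Fintype β] (G : Graph α β) [G.Loopless] (σ : β → ℤˣ) (k : ℕ) : Prop :=
  ∃ (τ : α → β → ℤˣ) (f : β → ℤ), IsNowhereZeroFlow G σ k τ f

/-- A signed graph is flow-admissible if it admits a nowhere-zero `k`-flow for some integer
`k ≥ 2`. -/
def FlowAdmissible [Fintype β] (G : Graph α β) [G.Loopless] (σ : β → ℤˣ) : Prop :=
  ∃ k : ℕ, 2 ≤ k ∧ AdmitsNowhereZeroFlow G σ k

end SignedGraph

namespace MobiusLadder

/-- The vertices of the Möbius ladder: `(i, false)` is `x_i` and `(i, true)` is `y_i`. -/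
abbrev Vertex (n : ℕ) : Type := Fin n × Bool

/-- The edges of the Möbius ladder: `Sum.inl i` is the rung at `i`, and `Sum.inr (i, b)` is the
rail edge leaving the vertex `(i, b)` in the direction of increasing index. -/
abbrev Edge (n : ℕ) : Type := Fin n ⊕ (Fin n × Bool)

/-- The ends of an edge. The rung at `i` joins `x_i` and `y_i`. For `i < n - 1` the rail edges at
`i` are `x_i x_{i+1}` and `y_i y_{i+1}`; those at `i = n - 1` (where `i + 1 = 0` in `Fin n`) are
`x_{n-1} y_0` and `y_{n-1} x_0`. -/
def ends (n : ℕ) [NeZero n] : Edge n → Vertex n × Vertex n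
  | Sum.inl i => ((i, false), (i, true))
  | Sum.inr (i, b) => ((i, b), (i + 1, if i + 1 = 0 then !b else b))

end MobiusLadder

/-- The Möbius ladder `ML_n` for `n ≥ 1`, as a cubic multigraph on `2n` vertices (for `n = 1` it
consists of two vertices joined by three parallel edges, and `ML_2` is the complete graph on four
vertices). -/
def mobiusLadder (n : ℕ) [NeZero n] : Graph (MobiusLadder.Vertex n) (MobiusLadder.Edge n) where
  vertexSet := Set.univ
  IsLink e u v := MobiusLadder.ends n e = (u, v) ∨ MobiusLadder.ends n e = (v, u)
  edgeSet := Set.univ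
  isLink_symm _ _ := ⟨fun _ _ h => h.symm⟩
  eq_or_eq_of_isLink_of_isLink := by
    rintro e x y v w (h | h) (h' | h') <;> rw [h] at h' <;> simp_all
  edge_mem_iff_exists_isLink e := by
    simp only [Set.mem_univ, true_iff]
    exact ⟨_, _, Or.inl rfl⟩
  left_mem_of_isLink := by simp

instance mobiusLadder_loopless (n : ℕ) [NeZero n] : (mobiusLadder n).Loopless where
  not_isLoopAt e x h := by
    have h : MobiusLadder.ends n e = (x, x) := by
      rcases h with h | h <;> exact h
    rcases e with i | ⟨i, b⟩
    · simp only [MobiusLadder.ends, Prod.mk.injEq] at h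
      grind
    · simp only [MobiusLadder.ends, Prod.mk.injEq] at h
      obtain ⟨h1, h2⟩ := h
      rw [← h1, Prod.mk.injEq] at h2
      obtain ⟨h2, h3⟩ := h2
      by_cases h0 : i + 1 = 0
      · simp [h0] at h3
      · have h4 : (1 : Fin n) = 0 := by simpa using h2
        have h5 : n = 1 := by
          by_contra hn
          have hn0 := NeZero.ne n
          have := congrArg Fin.val h4
          rw [Fin.val_one', Nat.mod_eq_of_lt (by omega)] at this
          simp at this
        subst h5
        exact h0 (Subsingleton.elim _ _)

/-! Walks of pairs of rail values along a word of rung signs. -/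

/-! Cut the ladder between its last and first rungs and switch so that the uncut rail edges are
positive. A flow becomes a walk of pairs (a, b) of rail values, one step per rung, that closes up
under an interchange of the rails with signs p, q. In the coordinates u = (a + b)/2, v = (a - b)/2 a
positive rung moves only v, a negative one only u, and the change is the rung value up to sign. Rail
values are nonzero when u ≠ ±v.

Negating one rail value (`ClosedWalk.flip`) reverses all signs, which leaves two cases. If p = q =
1, closing up fixes u and reverses v, and the only obstruction is a single negative rung: u cannot
move once and return. If q = -p, closing up is a quarter turn of (u, v), and the only obstruction is
a word made of a block of one sign followed by a possibly empty block of the other. Without an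
obstruction, a walk through a 3 × 3 grid, whose coordinates move independently (`walk_grid`), closes
up with values at most 5 (`ClosedWalk.six`). -/

namespace LadderWord

/-- A pair of rail values is admissible for `k` if both are nonzero and less than `k` in
absolute value. -/
def Admissible (k : ℤ) (s : ℤ × ℤ) : Prop :=
  (s.1 ≠ 0 ∧ |s.1| < k) ∧ (s.2 ≠ 0 ∧ |s.2| < k)

/-- Passing a rung of sign `ε` that carries the nonzero value `s.1 - t.1`, the rail values change
from `s` to `t`. -/
def Step (k : ℤ) (ε : ℤˣ) (s t : ℤ × ℤ) : Prop :=
  Admissible k s ∧ Admissible k t ∧ (s.1 - t.1 ≠ 0 ∧ |s.1 - t.1| < k) ∧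
    t.2 = s.2 + ε * (s.1 - t.1)

instance (k : ℤ) (s : ℤ × ℤ) : Decidable (Admissible k s) :=
  inferInstanceAs (Decidable (_ ∧ _))

instance (k : ℤ) (ε : ℤˣ) (s t : ℤ × ℤ) : Decidable (Step k ε s t) :=
  inferInstanceAs (Decidable (_ ∧ _))

/-- The rail values can change from `s` to `t` along the word `w` of rung signs. -/
def Walk (k : ℤ) : List ℤˣ → ℤ × ℤ → ℤ × ℤ → Prop
  | [], s, t => s = t
  | ε :: w, s, t => ∃ m, Step k ε s m ∧ Walk k w m t

/-- The closing map: the two rails are interchanged with signs `p` and `q`. -/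
def twist (p q : ℤˣ) (s : ℤ × ℤ) : ℤ × ℤ := (p * s.2, q * s.1)

/-- There is a walk along `w` that closes up under the twist with signs `p` and `q`. -/
def ClosedWalk (k : ℤ) (w : List ℤˣ) (p q : ℤˣ) : Prop :=
  ∃ t, Walk k w (twist p q t) t

lemma walk_append {k : ℤ} {w₁ w₂ : List ℤˣ} {s t : ℤ × ℤ} :
    Walk k (w₁ ++ w₂) s t ↔ ∃ m, Walk k w₁ s m ∧ Walk k w₂ m t := by
  induction w₁ generalizing s with
  | nil => simp [Walk]
  | cons ε w ih =>
    simp only [List.cons_append, Walk, ih]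
    constructor
    · rintro ⟨m, h, m', h', h''⟩
      exact ⟨m', ⟨m, h, h'⟩, h''⟩
    · rintro ⟨m', ⟨m, h, h'⟩, h''⟩
      exact ⟨m, h, m', h', h''⟩

/-! ### Symmetries of walks -/

/-- Negating the second rail value. -/
def flip (s : ℤ × ℤ) : ℤ × ℤ := (s.1, -s.2)

lemma Step.flip {k : ℤ} {ε : ℤˣ} {s t : ℤ × ℤ} (h : Step k ε s t) :
    Step k (-ε) (flip s) (flip t) := by
  obtain ⟨⟨h1, h2⟩, ⟨h3, h4⟩, h5, h6⟩ := h
  refine ⟨⟨h1, ?_⟩, ⟨h3, ?_⟩, h5, ?_⟩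
  · simpa [LadderWord.flip] using h2
  · simpa [LadderWord.flip] using h4
  · simp only [LadderWord.flip, h6]
    push_cast
    ring

lemma Walk.flip {k : ℤ} {w : List ℤˣ} {s t : ℤ × ℤ} (h : Walk k w s t) :
    Walk k (w.map (- ·)) (flip s) (flip t) := by
  induction w generalizing s with
  | nil => exact congrArg _ h
  | cons ε w ih =>
    obtain ⟨m, h1, h2⟩ := h
    exact ⟨_, h1.flip, ih h2⟩

lemma ClosedWalk.flip {k : ℤ} {w : List ℤˣ} {p q : ℤˣ} (h : ClosedWalk k w p q) :
    ClosedWalk k (w.map (- ·)) (-p) (-q) := by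
  obtain ⟨t, h⟩ := h
  refine ⟨LadderWord.flip t, ?_⟩
  convert h.flip using 1
  simp [twist, LadderWord.flip]

lemma ClosedWalk.of_flip {k : ℤ} {w : List ℤˣ} {p q : ℤˣ}
    (h : ClosedWalk k (w.map (- ·)) (-p) (-q)) : ClosedWalk k w p q := by
  simpa [Function.comp_def] using h.flip

/-- With opposite signs the twist exchanges sum and difference up to sign, hence the two kinds of
rungs. -/
lemma Step.twist {k : ℤ} {ε p : ℤˣ} {s t : ℤ × ℤ} (h : Step k ε s t) :
    Step k (-ε) (twist p (-p) s) (twist p (-p) t) := by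
  obtain ⟨⟨h1, h2⟩, ⟨h3, h4⟩, h5, h6⟩ := h
  have h7 : s.2 - t.2 = -ε * (s.1 - t.1) := by rw [h6]; ring
  rcases Int.units_eq_one_or p with rfl | rfl <;> rcases Int.units_eq_one_or ε with rfl | rfl <;>
    simp only [Step, Admissible, LadderWord.twist, Units.val_neg, Units.val_one, neg_neg, one_mul,
      neg_mul, abs_neg, neg_ne_zero, ne_eq] at * <;>
    refine ⟨⟨h2, h1⟩, ⟨h4, h3⟩, ?_, by linarith⟩ <;>
    grind

lemma Walk.twist {k : ℤ} {p : ℤˣ} {w : List ℤˣ} {s t : ℤ × ℤ} (h : Walk k w s t) :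
    Walk k (w.map (- ·)) (twist p (-p) s) (twist p (-p) t) := by
  induction w generalizing s with
  | nil => exact congrArg _ h
  | cons ε w ih =>
    obtain ⟨m, h1, h2⟩ := h
    exact ⟨_, h1.twist, ih h2⟩

/-! ### Invariants and obstructions -/

lemma Walk.sum_eq {k : ℤ} {w : List ℤˣ} {s t : ℤ × ℤ} (h : Walk k w s t) (hw : -1 ∉ w) :
    t.1 + t.2 = s.1 + s.2 := by
  induction w generalizing s with
  | nil => rw [show s = t from h]
  | cons ε w ih =>
    obtain ⟨m, ⟨-, -, -, h1⟩, h2⟩ := h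
    simp only [List.mem_cons, not_or] at hw
    obtain rfl : ε = 1 := (Int.units_eq_one_or ε).resolve_right (Ne.symm hw.1)
    rw [ih h2 hw.2, h1]
    push_cast
    ring

lemma Walk.sub_eq {k : ℤ} {w : List ℤˣ} {s t : ℤ × ℤ} (h : Walk k w s t) (hw : 1 ∉ w) :
    t.1 - t.2 = s.1 - s.2 := by
  have := h.flip.sum_eq (by simpa using hw)
  simpa [LadderWord.flip, ← sub_eq_add_neg] using this

/-- A balanced rail twist and a single negative rung exclude a flow. -/
lemma not_closedWalk_of_count_eq_one {k : ℤ} {w : List ℤˣ} (hw : w.count (-1) = 1) :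
    ¬ ClosedWalk k w 1 1 := by
  rintro ⟨t, h⟩
  obtain ⟨w₁, w₂, rfl⟩ := List.append_of_mem (List.count_pos_iff.1 (hw ▸ one_pos))
  have h0 : List.count (-1) w₁ = 0 ∧ List.count (-1) w₂ = 0 := by
    simp at hw
    omega
  obtain ⟨m, h1, m', ⟨-, -, ⟨h2, -⟩, h3⟩, h4⟩ := walk_append.1 h
  -- Positive rungs and the twist keep the sum, so the negative rung must keep it too and would
  -- carry 0.
  have h5 := h1.sum_eq (List.count_eq_zero.1 h0.1)
  have h6 := h4.sum_eq (List.count_eq_zero.1 h0.2)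
  simp [twist] at h5 h3
  omega

lemma Walk.admissible_left {k : ℤ} {w : List ℤˣ} {s t : ℤ × ℤ} (h : Walk k w s t)
    (hw : w ≠ []) : Admissible k s := by
  cases w with
  | nil => exact absurd rfl hw
  | cons ε w => exact h.choose_spec.1.1

lemma Walk.admissible_right {k : ℤ} {w : List ℤˣ} {s t : ℤ × ℤ} (h : Walk k w s t)
    (hs : Admissible k s) : Admissible k t := by
  induction w generalizing s with
  | nil => exact (show s = t from h) ▸ hs
  | cons ε w ih =>
    obtain ⟨m, h1, h2⟩ := h
    exact ih h2 h1.2.1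

/-- Negative rungs followed by positive rungs, closed up by a rotation, exclude a flow. -/
lemma not_closedWalk_append {k : ℤ} {w₁ w₂ : List ℤˣ} {p : ℤˣ} (hw : w₁ ≠ []) (h₁ : 1 ∉ w₁)
    (h₂ : -1 ∉ w₂) : ¬ ClosedWalk k (w₁ ++ w₂) p (-p) := by
  rintro ⟨t, h⟩
  obtain ⟨m, h1, h2⟩ := walk_append.1 h
  -- Both invariants are read off at `m`: m.1 - m.2 = p (m.1 + m.2), so an entry of `m` vanishes.
  have h3 := h1.sub_eq h₁
  have h4 := h2.sum_eq h₂
  obtain ⟨⟨h5, -⟩, h6, -⟩ := h1.admissible_right (h1.admissible_left hw)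
  rcases Int.units_eq_one_or p with rfl | rfl <;> simp [twist] at h3 <;> omega

/-! ### Closed walks with values at most 5 -/

/-- The endpoints `x` and `y` are joined by a walk of length `c` in the triangle. -/
def Joined (x y : Fin 3) (c : ℕ) : Prop := (c = 0 → x = y) ∧ (c = 1 → x ≠ y)

lemma Joined.exists_next {x y : Fin 3} {c : ℕ} (h : Joined x y (c + 1)) :
    ∃ z, z ≠ x ∧ Joined z y c := by
  match c with
  | 0 => exact ⟨y, (h.2 rfl).symm, by simp [Joined]⟩
  | 1 =>
    obtain ⟨z, h1, h2⟩ : ∃ z : Fin 3, z ≠ x ∧ z ≠ y := by clear h; decide +revert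
    exact ⟨z, h1, by simp [Joined, h2]⟩
  | c + 2 =>
    obtain ⟨z, h1⟩ := exists_ne x
    exact ⟨z, h1, by simp [Joined]⟩

/-- In a grid of states the two coordinates can be moved independently. -/
lemma walk_grid {k : ℤ} (g : Fin 3 → Fin 3 → ℤ × ℤ) {w : List ℤˣ}
    (hneg : ∀ i i' j, i' ≠ i → Step k (-1) (g i j) (g i' j))
    (hpos : 1 ∈ w → ∀ i j j', j' ≠ j → Step k 1 (g i j) (g i j')) {i i' j j' : Fin 3}
    (hi : Joined i i' (w.count (-1))) (hj : Joined j j' (w.count 1)) :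
    Walk k w (g i j) (g i' j') := by
  induction w generalizing i j with
  | nil => simp_all [Joined, Walk]
  | cons ε w ih =>
    have ih := @ih (fun h => hpos (List.mem_cons_of_mem _ h))
    rcases Int.units_eq_one_or ε with rfl | rfl
    · rw [List.count_cons_self] at hj
      rw [List.count_cons_of_ne (by decide)] at hi
      obtain ⟨z, h1, h2⟩ := hj.exists_next
      exact ⟨_, hpos (by simp) _ _ _ h1, ih hi h2⟩
    · rw [List.count_cons_self] at hi
      rw [List.count_cons_of_ne (by decide)] at hj
      obtain ⟨z, h1, h2⟩ := hi.exists_next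
      exact ⟨_, hneg _ _ _ h1, ih h2 hj⟩

/-- The state with half sum `u` and half difference `v`. -/
def ofSumDiff (u v : ℤ) : ℤ × ℤ := (u + v, u - v)

/-- Here u returns to 0 and v goes from 1 to -1. Even u and odd v make both rail values odd, hence
nonzero. -/
lemma closedWalk_of_count_ne_one {w : List ℤˣ} (hw : w.count (-1) ≠ 1) :
    ClosedWalk 6 w 1 1 := by
  by_cases h : 1 ∈ w
  · refine ⟨ofSumDiff 0 (-1), ?_⟩
    refine walk_grid (k := 6) (fun i j => ofSumDiff (![0, 2, -2] i) (![-1, 1, 3] j)) (by decide)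
      (fun _ => by decide) (i := 0) (i' := 0) (j := 1) (j' := 0) ?_ ?_
    · simp [Joined, hw]
    · simpa [Joined, List.count_eq_zero] using h
  -- Without positive rungs v is constant, so it must be 0.
  · refine ⟨ofSumDiff 1 0, ?_⟩
    refine walk_grid (k := 6) (fun i _ => ofSumDiff (![1, 2, -1] i) 0) (by decide)
      (fun h' => absurd h' h) (i := 0) (i' := 0) (j := 0) (j' := 0) ?_ ?_
    · simp [Joined, hw]
    · simp [Joined, List.count_eq_zero.2 h]

/-- The walk that realizes a rotation: it needs a positive rung at both ends of the word and a
negative rung in between. -/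
lemma walk_rotation {w : List ℤˣ} (hw : -1 ∈ w) (p : ℤˣ) :
    Walk 6 ((1 :: w) ++ [1]) (ofSumDiff 0 1) (ofSumDiff p 0) := by
  -- The grid avoids v = 1 and v = 0, where some u gives a zero rail value; the two outer positive
  -- rungs enter and leave it.
  let g : Fin 3 → Fin 3 → ℤ × ℤ := fun i j => ofSumDiff (![0, 1, -1] i) (![2, -2, 3] j)
  obtain ⟨i, hi, hp⟩ : ∃ i : Fin 3, 0 ≠ i ∧ (p : ℤ) = ![0, 1, -1] i := by
    rcases Int.units_eq_one_or p with rfl | rfl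
    exacts [⟨1, by decide⟩, ⟨2, by decide⟩]
  obtain ⟨j, hj, hjw⟩ : ∃ j : Fin 3, j ≠ 2 ∧ Joined 0 j (w.count 1) := by
    by_cases h : w.count 1 = 0
    · exact ⟨0, by decide, by simp [Joined, h]⟩
    · exact ⟨1, by decide, by simp [Joined, h]⟩
  have hiw : Joined 0 i (w.count (-1)) :=
    ⟨fun h => absurd hw (List.count_eq_zero.1 h), fun _ => hi⟩
  refine walk_append.2 ⟨g i j, ⟨g 0 0, by decide, walk_grid g (by decide) (fun _ => by decide)
    hiw hjw⟩, ofSumDiff p 0, ?_, rfl⟩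
  rw [hp]
  clear hiw hjw hp
  revert i j
  decide

lemma exists_eq_replicate_append (ε : ℤˣ) (w : List ℤˣ) :
    ∃ a w', w = List.replicate a ε ++ w' ∧ (w' = [] ∨ ∃ w'', w' = -ε :: w'') := by
  induction w with
  | nil => exact ⟨0, [], rfl, Or.inl rfl⟩
  | cons δ w ih =>
    by_cases h : δ = ε
    · obtain ⟨a, w', rfl, h'⟩ := ih
      exact ⟨a + 1, w', by simp [h, List.replicate_succ], h'⟩
    · exact ⟨0, δ :: w, rfl, Or.inr ⟨w, by
        rw [Int.units_ne_iff_eq_neg.1 h]⟩⟩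

/-- Rotation case, for words that start with a negative rung. -/
lemma closedWalk_rotation_of_cons {k : ℤ} {w : List ℤˣ} {p : ℤˣ}
    (h : ClosedWalk k (-1 :: w) p (-p)) : ClosedWalk 6 (-1 :: w) p (-p) := by
  obtain ⟨a, w', rfl, rfl | ⟨w, rfl⟩⟩ := exists_eq_replicate_append (-1) w
  · refine absurd h ?_
    rw [← List.cons_append]
    exact not_closedWalk_append (by simp) (by simp [List.mem_replicate]) (by simp)
  · by_cases hw : -1 ∈ w
    -- The initial negative block, moved to the end through the twist, becomes positive. The walk
    -- for this rotated word is cut before that block, and its tail is twisted back to the front.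
    · have h1 : -1 ∈ w ++ List.replicate a 1 := by simp [hw]
      have h2 := walk_rotation h1 p
      rw [← List.cons_append, List.append_assoc, ← List.replicate_succ', walk_append] at h2
      obtain ⟨t, h3, h4⟩ := h2
      refine ⟨t, ?_⟩
      rw [← List.cons_append, ← List.replicate_succ, walk_append]
      refine ⟨ofSumDiff 0 1, ?_, by simpa using h3⟩
      have h5 := h4.twist (p := p)
      rw [List.map_replicate] at h5
      convert h5 using 1
      rcases Int.units_eq_one_or p with rfl | rfl <;> decide
    · refine absurd h ?_
      rw [← List.cons_append]
      refine not_closedWalk_append (by simp) (by simp [List.mem_replicate]) ?_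
      simpa using hw

/-- A closed walk with unbounded values can be replaced by one with values at most `5`. -/
theorem ClosedWalk.six {k : ℤ} {w : List ℤˣ} {p q : ℤˣ} (hw : w ≠ []) (h : ClosedWalk k w p q) :
    ClosedWalk 6 w p q := by
  by_cases hpq : p = q
  · subst hpq
    rcases Int.units_eq_one_or p with rfl | rfl
    · exact closedWalk_of_count_ne_one fun hc => not_closedWalk_of_count_eq_one hc h
    · refine ClosedWalk.of_flip ?_
      have h := h.flip
      rw [neg_neg] at h ⊢
      exact closedWalk_of_count_ne_one fun hc => not_closedWalk_of_count_eq_one hc h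
  · obtain rfl : q = -p := Int.units_ne_iff_eq_neg.1 (Ne.symm hpq)
    cases w with
    | nil => exact absurd rfl hw
    | cons ε w =>
      rcases Int.units_eq_one_or ε with rfl | rfl
      · exact ClosedWalk.of_flip (closedWalk_rotation_of_cons h.flip)
      · exact closedWalk_rotation_of_cons h

end LadderWord

/-! ### Flows in local coordinates -/

namespace MobiusLadder

open SignedGraph LadderWord

variable {n : ℕ} [NeZero n]

/-- The tail of the rail edge that ends at a given vertex. -/
def prev (v : Vertex n) : Vertex n := (v.1 - 1, if v.1 = 0 then !v.2 else v.2)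

lemma ends_prev (v : Vertex n) : ends n (Sum.inr (prev v)) = (prev v, v) := by
  obtain ⟨i, b⟩ := v
  by_cases h : i = 0 <;> simp [prev, ends, h]

lemma eq_prev_of_ends {v w : Vertex n} (h : (ends n (Sum.inr w)).2 = v) : w = prev v := by
  obtain ⟨i, b⟩ := w
  subst h
  by_cases h : i + 1 = 0
  · simp [prev, ends, h, ← eq_neg_of_add_eq_zero_left h]
  · simp [prev, ends, h]

/-- This includes `n = 1`, where the rails cross. -/
lemma prev_ne (v : Vertex n) : prev v ≠ v := by
  intro h
  have h1 := (mobiusLadder_loopless n).not_isLoopAt (Sum.inr v) v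
  refine h1 (Or.inl ?_)
  have h2 := ends_prev v
  rwa [h] at h2

lemma inc_iff {e : Edge n} {v : Vertex n} :
    (mobiusLadder n).Inc e v ↔ e = Sum.inl v.1 ∨ e = Sum.inr v ∨ e = Sum.inr (prev v) := by
  constructor
  · rintro ⟨w, h⟩
    rcases e with i | e
    · rcases h with h | h <;> simp only [ends, Prod.mk.injEq] at h <;> left
      · rw [← h.1]
      · rw [← h.2]
    · rcases h with h | h
      · have h1 : e = v := congrArg Prod.fst h
        simp [h1]
      · have h1 := eq_prev_of_ends (congrArg Prod.snd h)
        simp [h1]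
  · rintro (rfl | rfl | rfl)
    · obtain ⟨i, rfl | rfl⟩ := v
      · exact ⟨_, Or.inl rfl⟩
      · exact ⟨_, Or.inr rfl⟩
    · exact ⟨_, Or.inl rfl⟩
    · exact ⟨_, Or.inr (ends_prev v)⟩

lemma boundary_eq (τ : Vertex n → Edge n → ℤˣ) (f : Edge n → ℤ) (v : Vertex n) :
    boundary (mobiusLadder n) τ f v = τ v (Sum.inl v.1) * f (Sum.inl v.1) +
      (τ v (Sum.inr v) * f (Sum.inr v) + τ v (Sum.inr (prev v)) * f (Sum.inr (prev v))) := by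
  classical
  have h : (Finset.univ.filter fun e => (mobiusLadder n).Inc e v) =
      {Sum.inl v.1, Sum.inr v, Sum.inr (prev v)} := by
    ext e
    simp [inc_iff]
  unfold boundary
  rw [← Finset.sum_pair (f := fun e => (τ v e : ℤ) * f e)
    (by simpa using (prev_ne v).symm), ← Finset.sum_insert
    (f := fun e => (τ v e : ℤ) * f e) (by simp), ← h]

/-- A flow in terms of the values `A` on the rail edges and `C` on the rungs, measured in the
direction of the standard orientation. -/
structure IsLocalFlow (σ : Edge n → ℤˣ) (k : ℕ) (A : Vertex n → ℤ) (C : Fin n → ℤ) : Prop where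
  rail : ∀ v, A v ≠ 0 ∧ |A v| < k
  rung : ∀ i, C i ≠ 0 ∧ |C i| < k
  left : ∀ i, A (i, false) = σ (Sum.inr (prev (i, false))) * A (prev (i, false)) - C i
  right : ∀ i, A (i, true) = σ (Sum.inr (prev (i, true))) * A (prev (i, true)) +
    σ (Sum.inl i) * C i

lemma abs_units_mul (u : ℤˣ) (x : ℤ) : |(u : ℤ) * x| = |x| := by
  rcases Int.units_eq_one_or u with rfl | rfl <;> simp

lemma units_mul_mul_cancel (u : ℤˣ) (x : ℤ) : (u : ℤ) * (u * x) = x := by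
  rcases Int.units_eq_one_or u with rfl | rfl <;> simp

lemma exists_isLocalFlow {σ : Edge n → ℤˣ} {k : ℕ}
    (h : AdmitsNowhereZeroFlow (mobiusLadder n) σ k) : ∃ A C, IsLocalFlow σ k A C := by
  obtain ⟨τ, f, h1, h2, h3, h4⟩ := h
  have hτ {u v : Vertex n} {e : Edge n} (h : (mobiusLadder n).IsLink e u v) (x : ℤ) :
      (τ v e : ℤ) * x = -σ e * (τ u e * x) := by
    have h5 := h1 h
    rw [← Units.val_neg, ← h5, ← mul_assoc, ← Units.val_mul, mul_right_comm,
      Int.units_mul_self, one_mul]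
  have hin (v : Vertex n) := hτ (Or.inl (ends_prev v)) (f (Sum.inr (prev v)))
  have hnd (u : ℤˣ) (e : Edge n) : (u : ℤ) * f e ≠ 0 ∧ |(u : ℤ) * f e| < k :=
    ⟨mul_ne_zero u.ne_zero (h4 e trivial), by rw [abs_units_mul]; exact h3 e trivial⟩
  refine ⟨fun v => τ v (Sum.inr v) * f (Sum.inr v),
    fun i => τ (i, false) (Sum.inl i) * f (Sum.inl i), fun v => hnd _ _, fun i => hnd _ _,
    fun i => ?_, fun i => ?_⟩
  · have h5 := h2 (i, false) trivial
    rw [boundary_eq, hin] at h5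
    linarith
  · have h5 := h2 (i, true) trivial
    rw [boundary_eq, hin, hτ (u := (i, false)) (Or.inl rfl)] at h5
    linarith

lemma IsLocalFlow.admitsNowhereZeroFlow {σ : Edge n → ℤˣ} {k : ℕ} {A : Vertex n → ℤ}
    {C : Fin n → ℤ} (h : IsLocalFlow σ k A C) : AdmitsNowhereZeroFlow (mobiusLadder n) σ k := by
  classical
  -- Every edge leaves its first end.
  refine ⟨fun v e => if v = (ends n e).1 then 1 else -σ e, Sum.elim C A, ?_, ?_, ?_, ?_⟩
  · intro e u v he
    have huv : u ≠ v := he.ne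
    rcases he with he | he <;> simp [he, huv, huv.symm]
  · rintro ⟨i, b⟩ -
    have hp := prev_ne (i, b)
    rw [boundary_eq, ends_prev]
    cases b
    · have := h.left i
      simp [ends, hp.symm]
      linarith
    · have := h.right i
      simp [ends, hp.symm]
      linarith
  · rintro (i | v) -
    exacts [(h.rung i).2, (h.rail v).2]
  · rintro (i | v) -
    exacts [(h.rung i).1, (h.rail v).1]

/-! ### Switching: local flows as closed walks -/

/-- The product of the signs of the first `i` edges of a rail. -/
def railSign (σ : Edge n → ℤˣ) (b : Bool) (i : ℕ) : ℤˣ :=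
  ∏ j ∈ Finset.range i, σ (Sum.inr (Fin.ofNat n j, b))

/-- The signs of the rungs after switching all rail edges but the last two to be positive. -/
def rungSign (σ : Edge n → ℤˣ) (i : Fin n) : ℤˣ :=
  σ (Sum.inl i) * railSign σ false i * railSign σ true i

lemma railSign_succ (σ : Edge n → ℤˣ) (b : Bool) (i : ℕ) :
    railSign σ b (i + 1) = railSign σ b i * σ (Sum.inr (Fin.ofNat n i, b)) :=
  Finset.prod_range_succ _ _

lemma railSign_zero (σ : Edge n → ℤˣ) (b : Bool) : railSign σ b 0 = 1 :=
  Finset.prod_range_zero _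

lemma walk_ofFn {k : ℤ} {n : ℕ} {ε : Fin n → ℤˣ} {s t : ℤ × ℤ} :
    Walk k (List.ofFn ε) s t ↔ ∃ x : ℕ → ℤ × ℤ, x 0 = s ∧ x n = t ∧
      ∀ i : Fin n, Step k (ε i) (x i) (x (i + 1)) := by
  induction n generalizing s with
  | zero =>
    simp only [List.ofFn_zero, Walk]
    exact ⟨fun h => ⟨fun _ => s, rfl, h, fun i => i.elim0⟩, fun ⟨x, h, h', _⟩ => h.symm.trans h'⟩
  | succ n ih =>
    simp only [List.ofFn_succ, Walk, ih]
    constructor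
    · rintro ⟨m, h, x, rfl, rfl, h'⟩
      refine ⟨fun i => Nat.casesOn i s x, rfl, rfl, Fin.cases h fun i => ?_⟩
      simpa using h' i
    · rintro ⟨x, rfl, rfl, h⟩
      exact ⟨x 1, h 0, fun i => x (i + 1), rfl, rfl, fun i => h i.succ⟩

lemma ofNat_val (i : Fin n) : Fin.ofNat n i = i :=
  Fin.ext (Nat.mod_eq_of_lt i.2)

lemma prev_zero (b : Bool) : prev ((0 : Fin n), b) = (Fin.ofNat n (n - 1), !b) := by
  have h : (0 - 1 : Fin n) = Fin.ofNat n (n - 1) := by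
    rw [sub_eq_iff_eq_add]
    refine Fin.ext ?_
    have h1 : n - 1 + 1 = n := Nat.sub_add_cancel NeZero.one_le
    simp [Fin.val_add, h1]
  simp only [prev, if_true, h]

lemma prev_succ {i : ℕ} (hi : i + 1 < n) (b : Bool) :
    prev ((⟨i + 1, hi⟩ : Fin n), b) = (Fin.ofNat n i, b) := by
  have h : (⟨i + 1, hi⟩ : Fin n) ≠ 0 := by
    simp [Fin.ext_iff]
  have h' : (⟨i + 1, hi⟩ - 1 : Fin n) = Fin.ofNat n i := by
    rw [sub_eq_iff_eq_add]
    refine Fin.ext ?_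
    simp [Fin.val_add, Nat.mod_eq_of_lt hi]
  simp only [prev, h, h', if_false]

/-- The value on the edge that enters `v`, measured in its direction near `v`. -/
def inflow (σ : Edge n → ℤˣ) (A : Vertex n → ℤ) (v : Vertex n) : ℤ :=
  σ (Sum.inr (prev v)) * A (prev v)

/-- At index 0 the entering edges are the two cut ones; the twist supplies both their crossing and
their signs. -/
lemma eq_inflow {σ : Edge n → ℤˣ} {A : Vertex n → ℤ} {x : ℕ → ℤ × ℤ}
    (h0 : x 0 = twist (railSign σ true n) (railSign σ false n) (x n))
    (hx : ∀ i : Fin n, x (i + 1) =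
      (railSign σ false i * A (i, false), railSign σ true i * A (i, true))) (i : Fin n) :
    x i = (railSign σ false i * inflow σ A (i, false),
      railSign σ true i * inflow σ A (i, true)) := by
  have key (j : ℕ) (hj : j < n) (b : Bool) (a : ℤ) :
      railSign σ b (j + 1) * (σ (Sum.inr (Fin.ofNat n j, b)) * a) = railSign σ b j * a := by
    rw [railSign_succ, Units.val_mul, mul_assoc, units_mul_mul_cancel]
  have hx' (j : ℕ) (hj : j < n) : x (j + 1) =
      (railSign σ false j * A (Fin.ofNat n j, false),
        railSign σ true j * A (Fin.ofNat n j, true)) := by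
    rw [show Fin.ofNat n j = ⟨j, hj⟩ from ofNat_val ⟨j, hj⟩]
    exact hx ⟨j, hj⟩
  have hn : n - 1 + 1 = n := Nat.sub_add_cancel NeZero.one_le
  have hn' : n - 1 < n := by omega
  obtain ⟨_ | j, hi⟩ := i
  · have h1 := hx' (n - 1) hn'
    have h2 (b : Bool) (a : ℤ) := key (n - 1) hn' b a
    rw [hn] at h1
    simp only [hn] at h2
    have h3 (b : Bool) : prev ((⟨0, hi⟩ : Fin n), b) = (Fin.ofNat n (n - 1), !b) := prev_zero b
    simp only [inflow, h3, h0, h1, twist, ← h2, Bool.not_false, Bool.not_true,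
      units_mul_mul_cancel, railSign_zero, Units.val_one, one_mul]
  · simp only [inflow, prev_succ hi, key j (by omega), hx' j (by omega)]

lemma IsLocalFlow.closedWalk {σ : Edge n → ℤˣ} {k : ℕ} {A : Vertex n → ℤ} {C : Fin n → ℤ}
    (h : IsLocalFlow σ k A C) :
    ClosedWalk k (List.ofFn (rungSign σ)) (railSign σ true n) (railSign σ false n) := by
  let y (i : ℕ) : ℤ × ℤ := (railSign σ false i * A (Fin.ofNat n i, false),
    railSign σ true i * A (Fin.ofNat n i, true))
  let x (i : ℕ) : ℤ × ℤ :=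
    Nat.casesOn i (twist (railSign σ true n) (railSign σ false n) (y (n - 1))) y
  have hn : x n = y (n - 1) := by
    rw [← Nat.sub_add_cancel (NeZero.one_le : 1 ≤ n)]
    rfl
  have h0 : x 0 = twist (railSign σ true n) (railSign σ false n) (x n) := by
    rw [hn]
    rfl
  have hx (i : Fin n) : x (i + 1) =
      (railSign σ false i * A (i, false), railSign σ true i * A (i, true)) := by
    change y i = _
    simp only [y, ofNat_val]
  refine ⟨x n, walk_ofFn.2 ⟨x, h0, rfl, fun i => ?_⟩⟩
  have hnd {u : ℤˣ} {a : ℤ} (ha : a ≠ 0 ∧ |a| < k) : (u : ℤ) * a ≠ 0 ∧ |(u : ℤ) * a| < k :=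
    ⟨mul_ne_zero u.ne_zero ha.1, by rw [abs_units_mul]; exact ha.2⟩
  have h1 : A (i, false) = inflow σ A (i, false) - C i := h.left i
  have h2 : A (i, true) = inflow σ A (i, true) + σ (Sum.inl i) * C i := h.right i
  have h3 : (railSign σ false i : ℤ) * inflow σ A (i, false) - railSign σ false i * A (i, false) =
      railSign σ false i * C i := by rw [h1]; ring
  rw [eq_inflow h0 hx, hx]
  refine ⟨⟨hnd (hnd (h.rail _)), hnd (hnd (h.rail _))⟩, ⟨hnd (h.rail _), hnd (h.rail _)⟩, ?_, ?_⟩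
  · rw [h3]
    exact hnd (h.rung i)
  · simp only [h3, h2, rungSign, Units.val_mul]
    linear_combination (-(railSign σ true i : ℤ) * σ (Sum.inl i)) *
      units_mul_mul_cancel (railSign σ false i) (C i)

lemma exists_isLocalFlow_of_closedWalk {σ : Edge n → ℤˣ} {k : ℕ}
    (h : ClosedWalk k (List.ofFn (rungSign σ)) (railSign σ true n) (railSign σ false n)) :
    ∃ A C, IsLocalFlow σ k A C := by
  obtain ⟨t, hw⟩ := h
  obtain ⟨x, h0, rfl, h⟩ := walk_ofFn.1 hw
  let A (v : Vertex n) : ℤ :=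
    railSign σ v.2 v.1 * if v.2 then (x (v.1 + 1)).2 else (x (v.1 + 1)).1
  have hx (i : Fin n) : x (i + 1) =
      (railSign σ false i * A (i, false), railSign σ true i * A (i, true)) := by
    simp [A, units_mul_mul_cancel]
  have hnd {u : ℤˣ} {a : ℤ} (ha : a ≠ 0 ∧ |a| < k) : (u : ℤ) * a ≠ 0 ∧ |(u : ℤ) * a| < k :=
    ⟨mul_ne_zero u.ne_zero ha.1, by rw [abs_units_mul]; exact ha.2⟩
  have hin (i : Fin n) := eq_inflow h0 hx i
  refine ⟨A, fun i => railSign σ false i * ((x i).1 - (x (i + 1)).1), ?_,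
    fun i => hnd (h i).2.2.1, fun i => ?_, fun i => ?_⟩
  · rintro ⟨i, _ | _⟩
    exacts [hnd (h i).2.1.1, hnd (h i).2.1.2]
  · change _ = inflow σ A (i, false) - _
    rw [hin, hx, mul_sub, units_mul_mul_cancel, units_mul_mul_cancel]
    ring
  · change _ = inflow σ A (i, true) + _
    have h1 := (h i).2.2.2
    have h2 : A (i, true) = railSign σ true i * (x (i + 1)).2 := rfl
    rw [h2, h1, hin]
    simp only [rungSign, Units.val_mul]
    rw [mul_add, units_mul_mul_cancel, mul_comm (_ * _ : ℤ) (railSign σ true i : ℤ), mul_assoc,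
      units_mul_mul_cancel]
    ring

end MobiusLadder

theorem theorem5p4 (n : ℕ) [NeZero n] (σ : MobiusLadder.Edge n → ℤˣ)
    (hσ : SignedGraph.FlowAdmissible (mobiusLadder n) σ) :
    SignedGraph.AdmitsNowhereZeroFlow (mobiusLadder n) σ 6 := by
  obtain ⟨k, -, hk⟩ := hσ
  obtain ⟨A, C, h⟩ := MobiusLadder.exists_isLocalFlow hk
  have hne : List.ofFn (MobiusLadder.rungSign σ) ≠ [] := by
    simpa [← List.length_eq_zero_iff] using NeZero.ne n
  obtain ⟨A, C, h⟩ := MobiusLadder.exists_isLocalFlow_of_closedWalk (k := 6)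
    (h.closedWalk.six hne)
  exact h.admitsNowhereZeroFlow
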